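/- Consider the followers' subgame $\mathcal{G}_F$ with $N \ge 2$ mobile users (MUs) and $M$ shards. The payment vector $\mathbf{P} = (P_1,\dots,P_M)$ announced by the leader is fixed, with $P_m \ge 0$; MU $n$ has resource capacity $R_n > 0$ and unit operational cost $C_n > 0$. Each MU $n$ chooses a strategy in $$\mathcal{S}_n = \Big\{ (r_n^1,\dots,r_n^M) \in \mathbb{R}^M : r_n^m \ge 0 \text{ for all } m,\ \sum_{m=1}^M r_n^m \le R_n \Big\},$$ and its utility is $$U_n = \sum_{m=1}^M \frac{r_n^m}{r_n^m + \sum_{i \ne n} r_i^m}\, P_m \;-\; C_n \sum_{m=1}^M r_n^m ,$$ where the fraction is read as $0$ if nobody contributes to shard $m$. A Nash equilibrium is a profile $(s_1^*,\dots,s_N^*) \in \mathcal{S}_1\times\dots\times\mathcal{S}_N$ such that for every $n$ and every $s_n' \in \mathcal{S}_n$, replacing $s_n^*$ by $s_n'$ while all other MUs keep their strategies does not increase $U_n$. Then for all such $\mathbf{P}$, $(R_n)$ and $(C_n)$ the game $\mathcal{G}_F$ has exactly one Nash equilibrium (in pure strategies). -/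

import Mathlib

/-- The followers' subgame for a fixed announced payment vector: `N` mobile users (MUs, the
followers) and `M` shards. `P m` is the payment of shard `m`, `R n` the resource capacity of MU `n`
and `C n` its unit operational cost. -/
structure FollowerGame (N M : ℕ) where
  P : Fin M → ℝ
  R : Fin N → ℝ
  C : Fin N → ℝ

namespace FollowerGame

variable {N M : ℕ}

/-- The strategy set of MU `n`: nonnegative contributions to the shards whose total does not exceed
the capacity `R n`. -/
def strategySet (G : FollowerGame N M) (n : Fin N) : Set (Fin M → ℝ) :=
  {s | (∀ m, 0 ≤ s m) ∧ ∑ m, s m ≤ G.R n}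

/-- The payoff that MU `n` receives from shard `m` under the profile `r` (`r i m` is the
contribution of MU `i` to shard `m`): the payment is shared in proportion to the contributions.
If nobody contributes to the shard, the quotient is `0 / 0 = 0`: nothing is paid. -/
noncomputable def shardPayoff (G : FollowerGame N M) (r : Fin N → Fin M → ℝ) (n : Fin N)
    (m : Fin M) : ℝ :=
  r n m / (r n m + ∑ i ∈ Finset.univ.erase n, r i m) * G.P m

/-- The utility of MU `n`: the sum of its payoffs minus its linear cost. -/
noncomputable def utility (G : FollowerGame N M) (r : Fin N → Fin M → ℝ) (n : Fin N) : ℝ :=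
  ∑ m, G.shardPayoff r n m - G.C n * ∑ m, r n m

/-- A (pure-strategy) Nash equilibrium: a feasible profile in which no MU can increase its utility
by a unilateral change to another feasible strategy. -/
def IsNashEquilibrium (G : FollowerGame N M) (r : Fin N → Fin M → ℝ) : Prop :=
  (∀ n, r n ∈ G.strategySet n) ∧
    ∀ n, ∀ s ∈ G.strategySet n, G.utility (Function.update r n s) n ≤ G.utility r n

end FollowerGame

/-! Utilities are concave in a player's own strategy, so equilibria are governed by first-order
conditions on the pseudo-gradient `gradient`. By the identity `sum_marginal_sub_mul_sub`, applied
shard by shard, this map is monotone (decreasing), and strictly so in a paying shard where no MU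
holds everything.

Uniqueness: adding the first-order conditions of two equilibria contradicts strict monotonicity
unless they agree on paying shards; unpaid shards stay empty because effort is costly.

Existence: payoffs jump at an empty shard, so continuity arguments on all feasible profiles break
down. Monotonicity instead solves Minty's inequality, tested only on `active` profiles. Near an
empty paying shard marginal payoffs blow up like `1 / t`, which forces the solution to be active
(`mem_active_of_minty`); a limit along segments then gives the first-order condition. -/

/-! ### Minty's inequality on compact convex sets -/

/-- Minty's variational inequality for finitely many test points. -/
theorem exists_forall_finset_minty {E : Type*} [NormedAddCommGroup E] [NormedSpace ℝ E]
    {K : Set E} (hK : IsCompact K) (hKc : Convex ℝ K) (hKn : K.Nonempty)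
    (Φ : E → E →L[ℝ] ℝ) (t : Finset E) (ht : ∀ y ∈ t, y ∈ K)
    (hΦ : ∀ x ∈ t, ∀ y ∈ t, (Φ x - Φ y) (x - y) ≤ 0) :
    ∃ x ∈ K, ∀ y ∈ t, Φ y (y - x) ≤ 0 := by
  classical
  by_contra! hcon
  -- `A` is affine, so `A '' K` is convex. If no `x` works, it misses the nonpositive orthant and
  -- can be strictly separated from it.
  let A : E → t → ℝ := fun x i => Φ i (i - x)
  have hAcont : Continuous A := by fun_prop
  have hVc : Convex ℝ (A '' K) := by
    rintro _ ⟨x, hx, rfl⟩ _ ⟨y, hy, rfl⟩ a b ha hb hab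
    refine ⟨a • x + b • y, hKc hx hy ha hb hab, ?_⟩
    funext i
    simp only [A, map_sub, map_add, map_smul, Pi.add_apply, Pi.smul_apply, smul_eq_mul]
    linear_combination (-(Φ i) (i : E)) * hab
  have hdisj : Disjoint (A '' K) (Set.Iic (0 : t → ℝ)) := by
    rw [Set.disjoint_left]
    rintro _ ⟨x, hx, rfl⟩ hle
    obtain ⟨y, hy, hpos⟩ := hcon x hx
    exact absurd (hle ⟨y, hy⟩) (not_le.2 hpos)
  obtain ⟨f, u, v, hfu, huv, hfv⟩ :=
    geometric_hahn_banach_compact_closed hVc (hK.image hAcont) (convex_Iic _) isClosed_Iic hdisj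
  have hv0 : v < 0 := by simpa using hfv 0 (by simp)
  have hfsum : ∀ w : t → ℝ, f w = ∑ i, w i * f (Pi.single i 1) := by
    intro w
    conv_lhs => rw [← Finset.univ_sum_single w, map_sum]
    refine Finset.sum_congr rfl fun i _ => ?_
    rw [← smul_eq_mul, ← map_smul, ← Pi.single_smul, smul_eq_mul, mul_one]
  have hcoef : ∀ i, f (Pi.single i 1) ≤ 0 := by
    intro i
    by_contra! hi
    have hc : v / f (Pi.single i 1) ≤ 0 := (div_neg_of_neg_of_pos hv0 hi).le
    -- Were the coefficient positive, this point of the orthant would have `f`-value exactly `v`.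
    have := hfv ((v / f (Pi.single i 1)) • Pi.single i 1) (by
      intro j
      by_cases hj : j = i
      · subst hj; simpa using hc
      · simp [hj])
    rw [map_smul, smul_eq_mul, div_mul_cancel₀ _ hi.ne'] at this
    exact lt_irrefl _ this
  set w : t → ℝ := fun i => -f (Pi.single i 1) with hw
  have hw0 : ∀ i, 0 ≤ w i := fun i => neg_nonneg.2 (hcoef i)
  have hpos : ∀ x ∈ K, 0 < ∑ i, w i * Φ i (i - x) := by
    intro x hx
    have h1 := hfu (A x) ⟨x, hx, rfl⟩
    rw [hfsum] at h1
    have h2 : ∑ i, w i * Φ i (i - x) = -∑ i, A x i * f (Pi.single i 1) := by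
      rw [← Finset.sum_neg_distrib]
      exact Finset.sum_congr rfl fun i _ => by simp only [hw, A]; ring
    linarith
  have hW : 0 < ∑ i, w i := by
    refine lt_of_le_of_ne (Finset.sum_nonneg fun i _ => hw0 i) fun h => ?_
    have hz := (Finset.sum_eq_zero_iff_of_nonneg fun i _ => hw0 i).1 h.symm
    obtain ⟨x, hx⟩ := hKn
    have := hpos x hx
    rw [Finset.sum_eq_zero fun i hi => by rw [hz i hi, zero_mul]] at this
    exact lt_irrefl _ this
  set W := ∑ i, w i with hWdef
  -- The weighted mean of the test points contradicts `hpos`: pairing `(i, j)` with `(j, i)`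
  -- produces monotonicity terms.
  have hxK : ∑ i, (w i / W) • (i : E) ∈ K :=
    hKc.sum_mem (fun i _ => div_nonneg (hw0 i) hW.le)
      (by rw [← Finset.sum_div, div_self hW.ne']) fun i _ => ht i i.2
  have h1 := hpos _ hxK
  have h2 : W * ∑ i, w i * Φ i (i - ∑ j, (w j / W) • (j : E))
      = ∑ i, ∑ j, w i * w j * Φ i (i - j) := by
    rw [Finset.mul_sum]
    refine Finset.sum_congr rfl fun i _ => ?_
    simp only [map_sub, map_sum, map_smul, smul_eq_mul, mul_sub, Finset.sum_sub_distrib]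
    rw [← Finset.sum_mul, ← Finset.mul_sum, Finset.mul_sum, Finset.mul_sum]
    congr 1
    · rw [hWdef]; ring
    · refine Finset.sum_congr rfl fun j _ => ?_
      field_simp
  have h3 : 2 * ∑ i, ∑ j, w i * w j * Φ i (i - j)
      = ∑ i, ∑ j, w i * w j * (Φ i - Φ j) (i - j : E) := by
    rw [two_mul]
    nth_rewrite 2 [Finset.sum_comm]
    rw [← Finset.sum_add_distrib]
    refine Finset.sum_congr rfl fun i _ => ?_
    rw [← Finset.sum_add_distrib]
    refine Finset.sum_congr rfl fun j _ => ?_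
    simp only [map_sub, sub_apply]
    ring
  have h4 : ∑ i, ∑ j, w i * w j * (Φ i - Φ j) (i - j : E) ≤ 0 :=
    Finset.sum_nonpos fun i _ => Finset.sum_nonpos fun j _ =>
      mul_nonpos_of_nonneg_of_nonpos (mul_nonneg (hw0 i) (hw0 j)) (hΦ i i.2 j j.2)
  nlinarith [mul_pos hW h1]

/-- Minty's variational inequality for a map that is monotone (decreasing) on a subset `D` of a
compact convex set has a solution. -/
theorem exists_forall_minty {E : Type*} [NormedAddCommGroup E] [NormedSpace ℝ E]
    {K D : Set E} (hK : IsCompact K) (hKc : Convex ℝ K) (hKn : K.Nonempty) (hD : D ⊆ K)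
    (Φ : E → E →L[ℝ] ℝ) (hΦ : ∀ x ∈ D, ∀ y ∈ D, (Φ x - Φ y) (x - y) ≤ 0) :
    ∃ x ∈ K, ∀ y ∈ D, Φ y (y - x) ≤ 0 := by
  classical
  -- For fixed `y` the condition is closed in `x`, with no continuity of `Φ` needed.
  have hne := hK.inter_iInter_nonempty (fun y : D => {x | Φ y (y - x) ≤ 0})
    (fun y => isClosed_le (by fun_prop) continuous_const) (fun s => by
      obtain ⟨x, hx, h⟩ := exists_forall_finset_minty hK hKc hKn Φ (s.image Subtype.val)
        (fun y hy => by
          obtain ⟨y, -, rfl⟩ := Finset.mem_image.1 hy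
          exact hD y.2)
        (fun x hx y hy => by
          obtain ⟨x, -, rfl⟩ := Finset.mem_image.1 hx
          obtain ⟨y, -, rfl⟩ := Finset.mem_image.1 hy
          exact hΦ x x.2 y y.2)
      refine ⟨x, hx, ?_⟩
      simp only [Set.mem_iInter]
      exact fun y hy => h y (Finset.mem_image_of_mem _ hy))
  obtain ⟨x, hx, h⟩ := hne
  simp only [Set.mem_iInter] at h
  exact ⟨x, hx, fun y hy => h ⟨y, hy⟩⟩

/-! ### Monotonicity of a single proportional-sharing contest -/

/-- Monotonicity identity for the marginal payoffs of a proportional-sharing contest. -/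
theorem sum_marginal_sub_mul_sub {ι : Type*} [Fintype ι] {x y : ι → ℝ}
    (hA : 0 < ∑ i, x i) (hB : 0 < ∑ i, y i) :
    ∑ n, ((∑ i, x i - x n) / (∑ i, x i) ^ 2 - (∑ i, y i - y n) / (∑ i, y i) ^ 2) * (x n - y n)
      = -((∑ i, x i - ∑ i, y i) ^ 2 / ((∑ i, x i) * ∑ i, y i)
            * (1 - ∑ n, x n / (∑ i, x i) * (y n / ∑ i, y i))
          + ∑ n, (x n / (∑ i, x i) - y n / ∑ i, y i) ^ 2) := by
  set A := ∑ i, x i with hAd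
  set B := ∑ i, y i with hBd
  -- Summed over `n`, the first term becomes `-(A - B) ^ 2 / (A * B)`.
  have h1 : ∀ n, ((A - x n) / A ^ 2 - (B - y n) / B ^ 2) * (x n - y n)
      = (1 / A - 1 / B) * (x n - y n) + (A - B) ^ 2 / (A * B) * (x n / A * (y n / B))
        - (x n / A - y n / B) ^ 2 := by
    intro n
    field_simp
    ring
  simp only [h1, Finset.sum_sub_distrib, Finset.sum_add_distrib, ← Finset.mul_sum]
  rw [← hAd, ← hBd]
  field_simp
  ring

theorem sum_share_mul_share_le_one {ι : Type*} [Fintype ι] {x y : ι → ℝ}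
    (hx : ∀ i, 0 ≤ x i) (hy : ∀ i, 0 ≤ y i) (hA : 0 < ∑ i, x i) (hB : 0 < ∑ i, y i) :
    ∑ n, x n / (∑ i, x i) * (y n / ∑ i, y i) ≤ 1 := by
  calc ∑ n, x n / (∑ i, x i) * (y n / ∑ i, y i)
      ≤ ∑ n, x n / (∑ i, x i) * 1 := by
        refine Finset.sum_le_sum fun n _ =>
          mul_le_mul_of_nonneg_left ?_ (div_nonneg (hx n) hA.le)
        exact (div_le_one hB).2 (Finset.single_le_sum (fun i _ => hy i) (Finset.mem_univ n))
    _ = 1 := by simp only [mul_one]; rw [← Finset.sum_div, div_self hA.ne']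

theorem sum_marginal_sub_mul_sub_nonpos {ι : Type*} [Fintype ι] {x y : ι → ℝ}
    (hx : ∀ i, 0 ≤ x i) (hy : ∀ i, 0 ≤ y i) (hA : 0 < ∑ i, x i) (hB : 0 < ∑ i, y i) :
    ∑ n, ((∑ i, x i - x n) / (∑ i, x i) ^ 2 - (∑ i, y i - y n) / (∑ i, y i) ^ 2) * (x n - y n)
      ≤ 0 := by
  rw [sum_marginal_sub_mul_sub hA hB]
  have h1 := sum_share_mul_share_le_one hx hy hA hB
  have h2 : 0 ≤ (∑ i, x i - ∑ i, y i) ^ 2 / ((∑ i, x i) * ∑ i, y i) := by positivity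
  have h3 : 0 ≤ ∑ n, (x n / (∑ i, x i) - y n / ∑ i, y i) ^ 2 := by positivity
  nlinarith [mul_nonneg h2 (sub_nonneg.2 h1)]

/-- The monotonicity is strict when no contestant of `x` holds everything. -/
theorem eq_of_sum_marginal_sub_mul_sub_nonneg {ι : Type*} [Fintype ι] {x y : ι → ℝ}
    (hx : ∀ i, 0 ≤ x i) (hy : ∀ i, 0 ≤ y i) (hA : 0 < ∑ i, x i) (hB : 0 < ∑ i, y i)
    (hlt : ∀ n, x n < ∑ i, x i)
    (h : 0 ≤ ∑ n, ((∑ i, x i - x n) / (∑ i, x i) ^ 2 - (∑ i, y i - y n) / (∑ i, y i) ^ 2)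
      * (x n - y n)) : x = y := by
  rw [sum_marginal_sub_mul_sub hA hB] at h
  have h1 := sum_share_mul_share_le_one hx hy hA hB
  have h2 : 0 ≤ (∑ i, x i - ∑ i, y i) ^ 2 / ((∑ i, x i) * ∑ i, y i) := by positivity
  have h3 : 0 ≤ ∑ n, (x n / (∑ i, x i) - y n / ∑ i, y i) ^ 2 := by positivity
  have h4 := mul_nonneg h2 (sub_nonneg.2 h1)
  have h5 : ∑ n, (x n / (∑ i, x i) - y n / ∑ i, y i) ^ 2 = 0 := by linarith
  have hshare : ∀ n, x n / (∑ i, x i) = y n / ∑ i, y i := fun n => by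
    have := (Finset.sum_eq_zero_iff_of_nonneg fun i _ => sq_nonneg _).1 h5 n (Finset.mem_univ n)
    exact sub_eq_zero.1 (pow_eq_zero_iff two_ne_zero |>.1 this)
  -- Shares being equal, this is a sum of squared shares, each share below 1. Hence the totals must
  -- agree as well.
  have h6 : ∑ n, x n / (∑ i, x i) * (y n / ∑ i, y i) < 1 := by
    obtain ⟨k, -, hk⟩ := Finset.exists_lt_of_sum_lt (s := Finset.univ) (f := fun _ : ι => (0 : ℝ))
      (g := x) (by simpa using hA)
    calc ∑ n, x n / (∑ i, x i) * (y n / ∑ i, y i)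
        = ∑ n, x n / (∑ i, x i) * (x n / ∑ i, x i) := by simp only [hshare]
      _ < ∑ n, x n / (∑ i, x i) * 1 := by
          refine Finset.sum_lt_sum (fun n _ => mul_le_mul_of_nonneg_left
            ((div_lt_one hA).2 (hlt n)).le (div_nonneg (hx n) hA.le)) ⟨k, Finset.mem_univ k, ?_⟩
          exact mul_lt_mul_of_pos_left ((div_lt_one hA).2 (hlt k)) (div_pos hk hA)
      _ = 1 := by simp only [mul_one]; rw [← Finset.sum_div, div_self hA.ne']
  have h7 : (∑ i, x i - ∑ i, y i) ^ 2 / ((∑ i, x i) * ∑ i, y i) = 0 := by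
    have h8 := sub_pos.2 h6
    nlinarith
  have h9 : ∑ i, x i = ∑ i, y i := by
    rw [div_eq_zero_iff, or_iff_left (mul_pos hA hB).ne', pow_eq_zero_iff two_ne_zero] at h7
    exact sub_eq_zero.1 h7
  funext n
  have := hshare n
  rw [← h9] at this
  exact (div_left_inj' hA.ne').1 this

/-! ### Concavity and the pseudo-gradient -/

open Filter Topology

/-- The slope inequality for the concave function `b ↦ b / (b + S)`. -/
theorem div_add_le_of_nonneg {a b S : ℝ} (hb : 0 ≤ b) (hS : 0 ≤ S) (ha : 0 < a + S) :
    b / (b + S) ≤ a / (a + S) + S / (a + S) ^ 2 * (b - a) := by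
  rcases (add_nonneg hb hS).eq_or_lt with h0 | h0
  · have hb0 : b = 0 := by linarith
    have hS0 : S = 0 := by linarith
    subst hb0 hS0
    simp only [add_zero] at ha ⊢
    simp [ha.ne']
  · have : a / (a + S) + S / (a + S) ^ 2 * (b - a) - b / (b + S)
        = S * (b - a) ^ 2 / ((a + S) ^ 2 * (b + S)) := by
      field_simp
      ring
    have h2 : 0 ≤ S * (b - a) ^ 2 / ((a + S) ^ 2 * (b + S)) := by positivity
    linarith

namespace FollowerGame

variable {N M : ℕ}

/-- The marginal utility of MU `n` in shard `m`. -/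
noncomputable def marginal (G : FollowerGame N M) (r : Fin N → Fin M → ℝ) (n : Fin N)
    (m : Fin M) : ℝ :=
  G.P m * ((∑ i, r i m - r n m) / (∑ i, r i m) ^ 2) - G.C n

/-- The pseudo-gradient of the game, as a linear form. -/
noncomputable def gradient (G : FollowerGame N M) (r : Fin N → Fin M → ℝ) :
    (Fin N → Fin M → ℝ) →L[ℝ] ℝ :=
  ∑ n, ∑ m, G.marginal r n m •
    ((ContinuousLinearMap.proj m : (Fin M → ℝ) →L[ℝ] ℝ).comp (ContinuousLinearMap.proj n))

theorem gradient_apply (G : FollowerGame N M) (r v : Fin N → Fin M → ℝ) :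
    G.gradient r v = ∑ n, ∑ m, G.marginal r n m * v n m := by
  simp [gradient]

/-- The feasible profiles. -/
def feasible (G : FollowerGame N M) : Set (Fin N → Fin M → ℝ) :=
  {r | ∀ n, r n ∈ G.strategySet n}

/-- The feasible profiles in which every paying shard has a contributor. -/
def active (G : FollowerGame N M) : Set (Fin N → Fin M → ℝ) :=
  {r | r ∈ G.feasible ∧ ∀ m, 0 < G.P m → 0 < ∑ i, r i m}

theorem convex_strategySet (G : FollowerGame N M) (n : Fin N) : Convex ℝ (G.strategySet n) := by
  rintro x ⟨hx, hx'⟩ y ⟨hy, hy'⟩ a b ha hb hab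
  refine ⟨fun m => add_nonneg (mul_nonneg ha (hx m)) (mul_nonneg hb (hy m)), ?_⟩
  simp only [Pi.add_apply, Pi.smul_apply, smul_eq_mul, Finset.sum_add_distrib, ← Finset.mul_sum]
  calc a * ∑ i, x i + b * ∑ i, y i ≤ a * G.R n + b * G.R n := by gcongr
    _ = G.R n := by rw [← add_mul, hab, one_mul]

theorem convex_feasible (G : FollowerGame N M) : Convex ℝ G.feasible :=
  fun _ hx _ hy _ _ ha hb hab n => G.convex_strategySet n (hx n) (hy n) ha hb hab

theorem isCompact_strategySet (G : FollowerGame N M) (n : Fin N) :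
    IsCompact (G.strategySet n) := by
  refine IsCompact.of_isClosed_subset
    (isCompact_univ_pi fun _ : Fin M => isCompact_Icc (a := (0 : ℝ)) (b := G.R n)) ?_ ?_
  · have h : G.strategySet n = (⋂ m, {s | 0 ≤ s m}) ∩ {s | ∑ m, s m ≤ G.R n} := by
      ext s
      simp [strategySet]
    rw [h]
    exact (isClosed_iInter fun m => isClosed_le continuous_const (continuous_apply m)).inter
      (isClosed_le (by fun_prop) continuous_const)
  · rintro s ⟨h0, h1⟩ m -
    exact ⟨h0 m, (Finset.single_le_sum (fun i _ => h0 i) (Finset.mem_univ m)).trans h1⟩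

theorem isCompact_feasible (G : FollowerGame N M) : IsCompact G.feasible := by
  have h := isCompact_univ_pi fun n => G.isCompact_strategySet n
  convert h using 1
  ext r
  simp [feasible]

/-- Linear costs have constant gradient and cancel, leaving one independent contest per shard. -/
theorem gradient_sub_apply_sub (G : FollowerGame N M) (x y : Fin N → Fin M → ℝ) :
    (G.gradient x - G.gradient y) (x - y) = ∑ m, G.P m *
      ∑ n, ((∑ i, x i m - x n m) / (∑ i, x i m) ^ 2
        - (∑ i, y i m - y n m) / (∑ i, y i m) ^ 2) * (x n m - y n m) := by
  rw [sub_apply, gradient_apply, gradient_apply, ← Finset.sum_sub_distrib]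
  simp only [← Finset.sum_sub_distrib, Finset.mul_sum]
  rw [Finset.sum_comm]
  refine Finset.sum_congr rfl fun m _ => Finset.sum_congr rfl fun n _ => ?_
  simp only [marginal, Pi.sub_apply]
  ring

theorem gradient_sub_apply_sub_nonpos (G : FollowerGame N M) (hP : ∀ m, 0 ≤ G.P m)
    {x y : Fin N → Fin M → ℝ} (hx : x ∈ G.active) (hy : y ∈ G.active) :
    (G.gradient x - G.gradient y) (x - y) ≤ 0 := by
  rw [gradient_sub_apply_sub]
  refine Finset.sum_nonpos fun m _ => ?_
  rcases (hP m).eq_or_lt with h | h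
  · rw [← h, zero_mul]
  · exact mul_nonpos_of_nonneg_of_nonpos h.le (sum_marginal_sub_mul_sub_nonpos
      (x := fun i => x i m) (y := fun i => y i m) (fun i => (hx.1 i).1 m) (fun i => (hy.1 i).1 m)
      (hx.2 m h) (hy.2 m h))

theorem sum_erase_eq (r : Fin N → Fin M → ℝ) (n : Fin N) (m : Fin M) :
    ∑ i ∈ Finset.univ.erase n, r i m = ∑ i, r i m - r n m :=
  eq_sub_of_add_eq' (Finset.add_sum_erase _ (fun i => r i m) (Finset.mem_univ n))

theorem shardPayoff_update (G : FollowerGame N M) (r : Fin N → Fin M → ℝ) (n : Fin N)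
    (s : Fin M → ℝ) (m : Fin M) :
    G.shardPayoff (Function.update r n s) n m
      = s m / (s m + (∑ i, r i m - r n m)) * G.P m := by
  rw [shardPayoff, Function.update_self, ← sum_erase_eq]
  congr 3
  refine Finset.sum_congr rfl fun i hi => ?_
  rw [Function.update_of_ne (Finset.ne_of_mem_erase hi)]

theorem utility_update (G : FollowerGame N M) (r : Fin N → Fin M → ℝ) (n : Fin N)
    (s : Fin M → ℝ) :
    G.utility (Function.update r n s) n
      = ∑ m, (s m / (s m + (∑ i, r i m - r n m)) * G.P m - G.C n * s m) := by
  simp only [utility, shardPayoff_update, Function.update_self, Finset.sum_sub_distrib,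
    Finset.mul_sum]

theorem utility_eq (G : FollowerGame N M) (r : Fin N → Fin M → ℝ) (n : Fin N) :
    G.utility r n
      = ∑ m, (r n m / (r n m + (∑ i, r i m - r n m)) * G.P m - G.C n * r n m) := by
  have := G.utility_update r n (r n)
  rwa [Function.update_eq_self] at this

theorem le_total {G : FollowerGame N M} {r : Fin N → Fin M → ℝ} (hr : r ∈ G.feasible)
    (n : Fin N) (m : Fin M) : r n m ≤ ∑ i, r i m :=
  Finset.single_le_sum (f := fun i => r i m) (fun i _ => (hr i).1 m) (Finset.mem_univ n)

/-- By concavity of the utilities, first-order optimality implies equilibrium. -/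
theorem isNashEquilibrium_of_gradient_le (G : FollowerGame N M) (hP : ∀ m, 0 ≤ G.P m)
    {x : Fin N → Fin M → ℝ} (hx : x ∈ G.active)
    (h : ∀ y ∈ G.feasible, G.gradient x (y - x) ≤ 0) : G.IsNashEquilibrium x := by
  refine ⟨hx.1, fun n s hs => ?_⟩
  have h1 := h (Function.update x n s) (fun i => by
    rcases eq_or_ne i n with rfl | hi
    · rwa [Function.update_self]
    · rw [Function.update_of_ne hi]; exact hx.1 i)
  rw [gradient_apply, Finset.sum_eq_single n
    (fun i _ hi => by simp [Function.update_of_ne hi]) (by simp)] at h1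
  simp only [Pi.sub_apply, Function.update_self] at h1
  rw [utility_update, utility_eq]
  refine le_trans ?_ (add_le_of_nonpos_right h1)
  rw [← Finset.sum_add_distrib]
  refine Finset.sum_le_sum fun m _ => ?_
  rcases (hP m).eq_or_lt with hm | hm
  · rw [marginal, ← hm]
    linarith
  · have h2 := mul_le_mul_of_nonneg_right (div_add_le_of_nonneg (a := x n m) (hs.1 m)
      (sub_nonneg.2 (le_total hx.1 n m)) (by rw [add_sub_cancel]; exact hx.2 m hm)) hm.le
    rw [add_sub_cancel] at h2 ⊢
    rw [marginal]
    linarith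

end FollowerGame

/-! ### Existence -/

/-- Along a segment from `x` to a profile `z` with at least two contributors, the marginal payoffs
in the direction `z - x`, rescaled by the parameter, have a nonnegative limit, which is positive
when nobody contributes in `x`. -/
theorem exists_tendsto_mul_marginal {ι : Type*} [Fintype ι] [Nonempty ι] {x z : ι → ℝ}
    (hx : ∀ i, 0 ≤ x i) (hz : ∀ i, 0 < z i) (hlt : ∀ i, z i < ∑ j, z j) :
    ∃ l : ℝ, 0 ≤ l ∧ (∑ i, x i = 0 → 0 < l) ∧
      Tendsto (fun t : ℝ => t * ∑ n, (∑ i, (x i + t * (z i - x i)) - (x n + t * (z n - x n))) /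
        (∑ i, (x i + t * (z i - x i))) ^ 2 * (z n - x n)) (𝓝[>] 0) (𝓝 l) := by
  rcases (Finset.sum_nonneg fun i (_ : i ∈ Finset.univ) => hx i).eq_or_lt with h0 | h0
  · have hx0 : ∀ i, x i = 0 := fun i =>
      (Finset.sum_eq_zero_iff_of_nonneg fun i _ => hx i).1 h0.symm i (Finset.mem_univ i)
    have hZ : 0 < ∑ j, z j := Finset.sum_pos (fun i _ => hz i) Finset.univ_nonempty
    have hpos : 0 < ∑ n, (∑ i, z i - z n) / (∑ i, z i) ^ 2 * z n :=
      Finset.sum_pos (fun n _ => mul_pos (div_pos (sub_pos.2 (hlt n)) (by positivity)) (hz n))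
        Finset.univ_nonempty
    -- For `x = 0` the sum is exactly a constant over `t`, so the rescaled function is constant.
    refine ⟨_, hpos.le, fun _ => hpos, tendsto_const_nhds.congr' ?_⟩
    filter_upwards [self_mem_nhdsWithin] with t ht
    have ht : 0 < t := ht
    simp only [hx0, zero_add, sub_zero, ← Finset.mul_sum]
    rw [Finset.mul_sum]
    refine Finset.sum_congr rfl fun n _ => ?_
    field_simp
  · refine ⟨0, le_rfl, fun h => absurd h h0.ne', ?_⟩
    have hc : ContinuousAt (fun t : ℝ => t * ∑ n, (∑ i, (x i + t * (z i - x i))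
        - (x n + t * (z n - x n))) / (∑ i, (x i + t * (z i - x i))) ^ 2 * (z n - x n)) 0 := by
      refine continuousAt_id.mul (tendsto_finsetSum _ fun n _ => ?_)
      refine ContinuousAt.mul (ContinuousAt.div (by fun_prop) (by fun_prop) ?_) continuousAt_const
      simpa using h0.ne'
    have := hc.tendsto
    rw [zero_mul] at this
    exact this.mono_left nhdsWithin_le_nhds

namespace FollowerGame

variable {N M : ℕ}

theorem exists_feasible_pos (G : FollowerGame N M) (hR : ∀ n, 0 < G.R n) :
    ∃ z ∈ G.feasible, ∀ n m, 0 < z n m := by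
  have hM : (0 : ℝ) < M + 1 := by positivity
  refine ⟨fun n _ => G.R n / (M + 1), fun n => ⟨fun _ => (div_pos (hR n) hM).le, ?_⟩,
    fun n _ => div_pos (hR n) hM⟩
  rw [Finset.sum_const, Finset.card_univ, Fintype.card_fin, nsmul_eq_mul, mul_div_assoc',
    div_le_iff₀ hM]
  nlinarith [hR n]

theorem gradient_segment_apply (G : FollowerGame N M) (x y : Fin N → Fin M → ℝ) (t : ℝ) :
    G.gradient (x + t • (y - x)) (y - x)
      = ∑ m, G.P m * ∑ n, (∑ i, (x i m + t * (y i m - x i m)) - (x n m + t * (y n m - x n m))) /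
          (∑ i, (x i m + t * (y i m - x i m))) ^ 2 * (y n m - x n m)
        - ∑ n, ∑ m, G.C n * (y n m - x n m) := by
  rw [gradient_apply]
  simp only [Finset.mul_sum]
  rw [Finset.sum_comm (s := (Finset.univ : Finset (Fin M)))]
  simp only [← Finset.sum_sub_distrib]
  refine Finset.sum_congr rfl fun n _ => Finset.sum_congr rfl fun m _ => ?_
  simp only [marginal, Pi.add_apply, Pi.smul_apply, Pi.sub_apply, smul_eq_mul]
  ring

/-- A solution of the Minty inequality leaves no paying shard without contributors. -/
theorem mem_active_of_minty (G : FollowerGame N M) (hN : 2 ≤ N) (hP : ∀ m, 0 ≤ G.P m)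
    (hR : ∀ n, 0 < G.R n) {x : Fin N → Fin M → ℝ} (hx : x ∈ G.feasible)
    (h : ∀ y ∈ G.active, G.gradient y (y - x) ≤ 0) : x ∈ G.active := by
  have : Nontrivial (Fin N) := Fin.nontrivial_iff_two_le.2 hN
  have : Nonempty (Fin N) := inferInstance
  obtain ⟨z, hz, hz0⟩ := G.exists_feasible_pos hR
  -- Two MUs are needed here: a sole contributor has zero marginal payoff.
  have hlt : ∀ m n, z n m < ∑ i, z i m := fun m n => by
    obtain ⟨k, hk⟩ := exists_ne n
    exact Finset.single_lt_sum (f := fun i => z i m) hk (Finset.mem_univ n) (Finset.mem_univ k)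
      (hz0 k m) fun i _ _ => (hz0 i m).le
  choose l hl0 hlpos hlim using fun m => exists_tendsto_mul_marginal
    (x := fun i => x i m) (z := fun i => z i m) (fun i => (hx i).1 m) (fun i => hz0 i m) (hlt m)
  -- The factor `t` comes from `y - x = t • (z - x)` in Minty's inequality; it tames the blow-up and
  -- kills the costs.
  have hlim' : Tendsto (fun t : ℝ => t * G.gradient (x + t • (z - x)) (z - x)) (𝓝[>] 0)
      (𝓝 (∑ m, G.P m * l m - 0 * ∑ n, ∑ m, G.C n * (z n m - x n m))) := by
    have h1 := (tendsto_finsetSum Finset.univ fun m _ => (hlim m).const_mul (G.P m)).sub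
      ((tendsto_id.mono_left nhdsWithin_le_nhds : Tendsto (fun t : ℝ => t) (𝓝[>] 0) (𝓝 0)).mul_const
        (∑ n, ∑ m, G.C n * (z n m - x n m)))
    refine h1.congr fun t => ?_
    rw [gradient_segment_apply, mul_sub, Finset.mul_sum (s := Finset.univ) (a := t)
      (f := fun m => G.P m * _)]
    congr 1
    exact Finset.sum_congr rfl fun m _ => mul_left_comm _ _ _
  have hle : ∑ m, G.P m * l m - 0 * ∑ n, ∑ m, G.C n * (z n m - x n m) ≤ 0 := by
    refine le_of_tendsto hlim' ?_
    filter_upwards [Ioo_mem_nhdsGT (zero_lt_one' ℝ)] with t ht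
    have hy : x + t • (z - x) ∈ G.active := by
      refine ⟨G.convex_feasible.add_smul_sub_mem hx hz ⟨ht.1.le, ht.2.le⟩, fun m _ => ?_⟩
      refine Finset.sum_pos (fun i _ => ?_) Finset.univ_nonempty
      simp only [Pi.add_apply, Pi.smul_apply, Pi.sub_apply, smul_eq_mul]
      nlinarith [mul_pos ht.1 (hz0 i m), mul_nonneg (sub_nonneg.2 ht.2.le) ((hx i).1 m)]
    have := h _ hy
    rwa [add_sub_cancel_left, map_smul, smul_eq_mul] at this
  refine ⟨hx, fun m hm => ?_⟩
  refine lt_of_le_of_ne (Finset.sum_nonneg fun i _ => (hx i).1 m) fun h0 => ?_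
  have h1 : G.P m * l m ≤ ∑ m, G.P m * l m :=
    Finset.single_le_sum (f := fun m => G.P m * l m) (fun m _ => mul_nonneg (hP m) (hl0 m))
      (Finset.mem_univ m)
  have h2 := mul_pos hm (hlpos m h0.symm)
  linarith

/-- Minty's device: the segment from `x` towards `y` is active short of `y`, so test there, divide
by `t` and let `t → 0`. Continuity at 0 holds because totals vanish only in unpaid shards. -/
theorem gradient_le_of_minty (G : FollowerGame N M) (hP : ∀ m, 0 ≤ G.P m)
    {x : Fin N → Fin M → ℝ} (hx : x ∈ G.active)
    (h : ∀ y ∈ G.active, G.gradient y (y - x) ≤ 0) {y : Fin N → Fin M → ℝ}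
    (hy : y ∈ G.feasible) : G.gradient x (y - x) ≤ 0 := by
  have hc : ContinuousAt (fun t : ℝ => G.gradient (x + t • (y - x)) (y - x)) 0 := by
    simp only [gradient_segment_apply]
    refine ContinuousAt.sub (tendsto_finsetSum _ fun m _ => ?_) continuousAt_const
    rcases (hP m).eq_or_lt with hm | hm
    · simp only [← hm, zero_mul]
      exact tendsto_const_nhds
    · refine continuousAt_const.mul (tendsto_finsetSum _ fun n _ => ?_)
      refine ContinuousAt.mul (ContinuousAt.div (by fun_prop) (by fun_prop) ?_) continuousAt_const
      simpa using (hx.2 m hm).ne'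
  have hlim := hc.tendsto.mono_left (nhdsWithin_le_nhds (s := Set.Ioi 0))
  rw [zero_smul, add_zero] at hlim
  refine le_of_tendsto hlim ?_
  filter_upwards [Ioo_mem_nhdsGT (zero_lt_one' ℝ)] with t ht
  have hmem : x + t • (y - x) ∈ G.active := by
    refine ⟨G.convex_feasible.add_smul_sub_mem hx.1 hy ⟨ht.1.le, ht.2.le⟩, fun m hm => ?_⟩
    have h1 : ∑ i, (x + t • (y - x)) i m = (1 - t) * ∑ i, x i m + t * ∑ i, y i m := by
      simp only [Finset.mul_sum, ← Finset.sum_add_distrib]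
      refine Finset.sum_congr rfl fun i _ => ?_
      simp only [Pi.add_apply, Pi.smul_apply, Pi.sub_apply, smul_eq_mul]
      ring
    rw [h1]
    exact add_pos_of_pos_of_nonneg (mul_pos (sub_pos.2 ht.2) (hx.2 m hm))
      (mul_nonneg ht.1.le (Finset.sum_nonneg fun i _ => (hy i).1 m))
  have h2 := h _ hmem
  rw [add_sub_cancel_left, map_smul, smul_eq_mul] at h2
  exact nonpos_of_mul_nonpos_right h2 ht.1

theorem exists_isNashEquilibrium (G : FollowerGame N M) (hN : 2 ≤ N) (hP : ∀ m, 0 ≤ G.P m)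
    (hR : ∀ n, 0 < G.R n) : ∃ r, G.IsNashEquilibrium r := by
  obtain ⟨z, hz, -⟩ := G.exists_feasible_pos hR
  obtain ⟨x, hx, h⟩ := exists_forall_minty (D := G.active) G.isCompact_feasible G.convex_feasible
    ⟨z, hz⟩ (fun _ hy => hy.1) G.gradient
    fun _ hx _ hy => G.gradient_sub_apply_sub_nonpos hP hx hy
  have hxa := G.mem_active_of_minty hN hP hR hx h
  exact ⟨x, G.isNashEquilibrium_of_gradient_le hP hxa fun y hy =>
    G.gradient_le_of_minty hP hxa h hy⟩

/-! ### First-order conditions and uniqueness -/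

namespace IsNashEquilibrium

variable {G : FollowerGame N M} {x : Fin N → Fin M → ℝ}

/-- Reducing a contribution without losing payoff would be profitable. -/
theorem payoff_lt (hx : G.IsNashEquilibrium x) (hC : ∀ n, 0 < G.C n) (n : Fin N) (m : Fin M)
    {a : ℝ} (ha : 0 ≤ a) (hlt : a < x n m) :
    a / (a + (∑ i, x i m - x n m)) * G.P m
      < x n m / (x n m + (∑ i, x i m - x n m)) * G.P m := by
  have hs : Function.update (x n) m a ∈ G.strategySet n := by
    have hle : ∀ k, Function.update (x n) m a k ≤ x n k := fun k => by
      rcases eq_or_ne k m with rfl | hk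
      · rw [Function.update_self]; exact hlt.le
      · rw [Function.update_of_ne hk]
    refine ⟨fun k => ?_, (Finset.sum_le_sum fun k _ => hle k).trans (hx.1 n).2⟩
    rcases eq_or_ne k m with rfl | hk
    · rwa [Function.update_self]
    · rw [Function.update_of_ne hk]; exact (hx.1 n).1 k
  have h := hx.2 n _ hs
  rw [utility_update, utility_eq, ← sub_nonpos, ← Finset.sum_sub_distrib,
    Finset.sum_eq_single m (fun k _ hk => by rw [Function.update_of_ne hk, sub_self])
      (by simp), Function.update_self] at h
  nlinarith [mul_lt_mul_of_pos_left hlt (hC n)]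

theorem eq_zero_of_payment_eq_zero (hx : G.IsNashEquilibrium x) (hC : ∀ n, 0 < G.C n)
    (n : Fin N) {m : Fin M} (hm : G.P m = 0) : x n m = 0 := by
  by_contra hne
  have := hx.payoff_lt hC n m le_rfl (lt_of_le_of_ne ((hx.1 n).1 m) (Ne.symm hne))
  simp [hm] at this

/-- In equilibrium every paying shard receives contributions from the opponents of any MU. -/
theorem lt_total (hx : G.IsNashEquilibrium x) (hP : ∀ m, 0 ≤ G.P m) (hR : ∀ n, 0 < G.R n)
    (hC : ∀ n, 0 < G.C n) (n : Fin N) {m : Fin M} (hm : 0 < G.P m) :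
    x n m < ∑ i, x i m := by
  refine lt_of_le_of_ne (le_total hx.1 n m) fun h0 => ?_
  rcases ((hx.1 n).1 m).eq_or_lt with hz | hpos
  · set S : Fin M → ℝ := fun k => ∑ i, x i k - x n k with hS
    have hS0 : ∀ k, 0 ≤ S k := fun k => sub_nonneg.2 (le_total hx.1 n k)
    have hSm : S m = 0 := sub_eq_zero.2 h0.symm
    -- If nobody serves shard `m`, scaling the own strategy by `1 - t` and putting `t * G.R n` there
    -- captures all of `P m`, at a loss of order `t`.
    have key : ∀ t : ℝ, 0 < t → t ≤ 1 →
        G.P m ≤ t * (∑ k, x n k / (x n k + S k) * G.P k + G.C n * G.R n) := by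
      intro t ht0 ht1
      let s : Fin M → ℝ := fun k => (1 - t) * x n k + if k = m then t * G.R n else 0
      have h1t := sub_nonneg.2 ht1
      have hs : s ∈ G.strategySet n := by
        refine ⟨fun k => add_nonneg (mul_nonneg h1t ((hx.1 n).1 k)) ?_, ?_⟩
        · split_ifs
          · exact (mul_pos ht0 (hR n)).le
          · exact le_rfl
        · simp only [s, Finset.sum_add_distrib, ← Finset.mul_sum, Finset.sum_ite_eq',
            Finset.mem_univ, if_true]
          nlinarith [mul_le_mul_of_nonneg_left (hx.1 n).2 h1t]
      have hk : ∀ k, (1 - t) * (x n k / (x n k + S k) * G.P k - G.C n * x n k)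
          + (if k = m then G.P m - t * (G.C n * G.R n) else 0)
          ≤ s k / (s k + S k) * G.P k - G.C n * s k := by
        intro k
        by_cases hkm : k = m
        · subst hkm
          have htR := mul_pos ht0 (hR n)
          simp only [s, ← hz, hSm, if_true, mul_zero, zero_add, add_zero, zero_div, zero_mul,
            sub_zero, div_self htR.ne']
          linarith
        · simp only [s, if_neg hkm, add_zero]
          have h1 : (1 - t) * (x n k / (x n k + S k))
              ≤ (1 - t) * x n k / ((1 - t) * x n k + S k) := by
            rcases (mul_nonneg h1t ((hx.1 n).1 k)).eq_or_lt with h | h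
            · rw [← mul_div_assoc, ← h, zero_div, zero_div]
            · rw [← mul_div_assoc]
              refine div_le_div_of_nonneg_left h.le (add_pos_of_pos_of_nonneg h (hS0 k)) ?_
              nlinarith [mul_nonneg ht0.le ((hx.1 n).1 k)]
          nlinarith [mul_le_mul_of_nonneg_right h1 (hP k)]
      have h := hx.2 n s hs
      rw [utility_update, utility_eq] at h
      have h2 := (Finset.sum_le_sum fun k (_ : k ∈ Finset.univ) => hk k).trans h
      simp only [Finset.sum_add_distrib, ← Finset.mul_sum, Finset.sum_ite_eq', Finset.mem_univ,
        if_true, Finset.sum_sub_distrib] at h2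
      have hsum : 0 ≤ ∑ k, x n k := Finset.sum_nonneg fun k _ => (hx.1 n).1 k
      have h3 := mul_nonneg ht0.le (mul_nonneg (hC n).le hsum)
      linarith
    set c := ∑ k, x n k / (x n k + S k) * G.P k + G.C n * G.R n
    -- `t = 1` gives `P m ≤ c`, so `t = P m / (2 * c)` is admissible and yields `P m ≤ P m / 2`.
    have h1 := key 1 one_pos le_rfl
    have hc : 0 < c := by linarith
    have h2 := key (G.P m / (2 * c)) (by positivity) ((div_le_one (by positivity)).2 (by linarith))
    have h3 : G.P m / (2 * c) * c = G.P m / 2 := by field_simp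
    linarith
  -- A sole contributor keeps the whole payment after halving its contribution.
  · have h := hx.payoff_lt hC n m (half_pos hpos).le (half_lt_self hpos)
    rw [← h0, sub_self, add_zero, add_zero, div_self hpos.ne', div_self (half_pos hpos).ne'] at h
    exact lt_irrefl _ h

/-- First-order optimality of a single MU in equilibrium. -/
theorem sum_marginal_mul_le (hx : G.IsNashEquilibrium x) (hP : ∀ m, 0 ≤ G.P m)
    (hR : ∀ n, 0 < G.R n) (hC : ∀ n, 0 < G.C n) (n : Fin N) {s : Fin M → ℝ}
    (hs : s ∈ G.strategySet n) : ∑ m, G.marginal x n m * (s m - x n m) ≤ 0 := by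
  have hT : ∀ m, 0 < G.P m → 0 < ∑ i, x i m := fun m hm =>
    ((hx.1 n).1 m).trans_lt (hx.lt_total hP hR hC n hm)
  -- `q t` is the difference quotient of the utility along the segment to `s`, with the factor `t`
  -- already cancelled.
  let q : ℝ → ℝ := fun t => ∑ m, (G.P m * ((∑ i, x i m - x n m) * (s m - x n m) /
    ((∑ i, x i m) * (∑ i, x i m + t * (s m - x n m)))) - G.C n * (s m - x n m))
  have hq0 : q 0 = ∑ m, G.marginal x n m * (s m - x n m) := by
    refine Finset.sum_congr rfl fun m _ => ?_
    rw [marginal, zero_mul, add_zero, sq]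
    ring
  have hc : ContinuousAt q 0 := by
    refine tendsto_finsetSum _ fun m _ => ContinuousAt.sub ?_ continuousAt_const
    rcases (hP m).eq_or_lt with hm | hm
    · simp only [← hm, zero_mul]
      exact continuousAt_const
    · refine continuousAt_const.mul (ContinuousAt.div (by fun_prop) (by fun_prop) ?_)
      simpa using (hT m hm).ne'
  rw [← hq0]
  refine le_of_tendsto (hc.tendsto.mono_left (nhdsWithin_le_nhds (s := Set.Ioi 0))) ?_
  filter_upwards [Ioo_mem_nhdsGT (zero_lt_one' ℝ)] with t ht
  have h := hx.2 n _ ((G.convex_strategySet n).add_smul_sub_mem (hx.1 n) hs ⟨ht.1.le, ht.2.le⟩)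
  rw [utility_update, utility_eq, ← sub_nonpos, ← Finset.sum_sub_distrib] at h
  refine nonpos_of_mul_nonpos_right (a := t) (le_trans (le_of_eq ?_) h) ht.1
  rw [Finset.mul_sum]
  refine Finset.sum_congr rfl fun m _ => ?_
  simp only [Pi.add_apply, Pi.smul_apply, Pi.sub_apply, smul_eq_mul]
  rcases (hP m).eq_or_lt with hm | hm
  · rw [← hm]
    ring
  · have hS := sub_pos.2 (hx.lt_total hP hR hC n hm)
    have hT' := hT m hm
    have hb : 0 < x n m + t * (s m - x n m) + (∑ i, x i m - x n m) := by
      nlinarith [mul_nonneg ht.1.le (hs.1 m), mul_nonneg (sub_nonneg.2 ht.2.le) ((hx.1 n).1 m)]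
    have hb' : x n m + t * (s m - x n m) + (∑ i, x i m - x n m)
        = ∑ i, x i m + t * (s m - x n m) := by ring
    rw [hb'] at hb ⊢
    rw [add_sub_cancel]
    field_simp
    ring

theorem gradient_le (hx : G.IsNashEquilibrium x) (hP : ∀ m, 0 ≤ G.P m)
    (hR : ∀ n, 0 < G.R n) (hC : ∀ n, 0 < G.C n) {y : Fin N → Fin M → ℝ} (hy : y ∈ G.feasible) :
    G.gradient x (y - x) ≤ 0 := by
  rw [gradient_apply]
  exact Finset.sum_nonpos fun n _ => hx.sum_marginal_mul_le hP hR hC n (hy n)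

theorem eq {y : Fin N → Fin M → ℝ} (hN : 0 < N) (hP : ∀ m, 0 ≤ G.P m) (hR : ∀ n, 0 < G.R n)
    (hC : ∀ n, 0 < G.C n) (hx : G.IsNashEquilibrium x) (hy : G.IsNashEquilibrium y) : x = y := by
  have hT : ∀ {r}, G.IsNashEquilibrium r → ∀ m, 0 < G.P m → 0 < ∑ i, r i m := fun hr m hm =>
    ((hr.1 ⟨0, hN⟩).1 m).trans_lt (hr.lt_total hP hR hC ⟨0, hN⟩ hm)
  have h1 := hx.gradient_le hP hR hC hy.1
  have h2 := hy.gradient_le hP hR hC hx.1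
  -- Each equilibrium is tested against the other; with monotonicity, every shard's term must then
  -- vanish.
  have h3 : 0 ≤ (G.gradient x - G.gradient y) (x - y) := by
    rw [← neg_sub x y, map_neg] at h1
    rw [sub_apply]
    linarith
  rw [gradient_sub_apply_sub] at h3
  have hnp : ∀ m, G.P m * ∑ n, ((∑ i, x i m - x n m) / (∑ i, x i m) ^ 2
      - (∑ i, y i m - y n m) / (∑ i, y i m) ^ 2) * (x n m - y n m) ≤ 0 := fun m => by
    rcases (hP m).eq_or_lt with h | h
    · rw [← h, zero_mul]
    · exact mul_nonpos_of_nonneg_of_nonpos h.le (sum_marginal_sub_mul_sub_nonpos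
        (x := fun i => x i m) (y := fun i => y i m) (fun i => (hx.1 i).1 m)
        (fun i => (hy.1 i).1 m) (hT hx m h) (hT hy m h))
  have hzero := (Finset.sum_eq_zero_iff_of_nonpos fun m _ => hnp m).1
    (le_antisymm (Finset.sum_nonpos fun m _ => hnp m) h3)
  funext n m
  rcases (hP m).eq_or_lt with hm | hm
  · rw [hx.eq_zero_of_payment_eq_zero hC n hm.symm, hy.eq_zero_of_payment_eq_zero hC n hm.symm]
  · have h4 := (mul_eq_zero.1 (hzero m (Finset.mem_univ m))).resolve_left hm.ne'
    exact congrFun (eq_of_sum_marginal_sub_mul_sub_nonneg (x := fun i => x i m)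
      (y := fun i => y i m) (fun i => (hx.1 i).1 m) (fun i => (hy.1 i).1 m) (hT hx m hm)
      (hT hy m hm) (fun i => hx.lt_total hP hR hC i hm) h4.ge) n

end IsNashEquilibrium

end FollowerGame

theorem theorem1 (N M : ℕ) (hN : 2 ≤ N) (G : FollowerGame N M)
    (hP : ∀ m, 0 ≤ G.P m) (hR : ∀ n, 0 < G.R n) (hC : ∀ n, 0 < G.C n) :
    ∃! r : Fin N → Fin M → ℝ, G.IsNashEquilibrium r := by
  obtain ⟨x, hx⟩ := G.exists_isNashEquilibrium hN hP hR
  exact ⟨x, hx, fun y hy => hy.eq (by omega) hP hR hC hx⟩
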